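/- **Setting.** An $\infty$-graph is a globular set $G=(G(m))_{m\ge 0}$ with sources and targets $s^{m+1}_m,t^{m+1}_m$; write $s^m_p,t^m_p$ for the iterated ones. An $\infty$-magma is an $\infty$-graph with reflexors $1^m_{m+1}:M(m)\to M(m+1)$ (with iterates $1^p_m$; $s$ and $t$ of $1^m_{m+1}(x)$ are $x$) and compositions $y\star^m_p x$ ($0\le p<m$, defined when $s^m_p(y)=t^m_p(x)$) satisfying the positional axioms: $s^m_{m-1}(y\star^m_{m-1}x)=s^m_{m-1}(x)$, $t^m_{m-1}(y\star^m_{m-1}x)=t^m_{m-1}(y)$, and for $p<m-1$ the maps $s^m_{m-1}$ and $t^m_{m-1}$ carry $y\star^m_p x$ to the $\star^{m-1}_p$-composite of the sources, respectively of the targets. An $(\infty,0)$-magma is an $\infty$-magma with reversors $j^m_p:M(m)\to M(m)$ ($0\le p<m$), where $j^{p+1}_p$ exchanges $s^{p+1}_p$ and $t^{p+1}_p$, and, for $m>p+1$, $s^m_{m-1}j^m_p=j^{m-1}_ps^m_{m-1}$ and $t^m_{m-1}j^m_p=j^{m-1}_pt^m_{m-1}$. In an $\infty$-magma, $\beta$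 is a $\circ^m_p$-inverse of an $m$-cell $\alpha$ if $\alpha\circ^m_p\beta=1^p_m(t^m_p\alpha)$ and $\beta\circ^m_p\alpha=1^p_m(s^m_p\alpha)$; then $\alpha$ is called $\circ^m_p$-invertible. A strict $(\infty,0)$-category is a strict $\infty$-category in which every $m$-cell has a $\circ^m_p$-inverse for all $0\le p<m$; it is an $(\infty,0)$-magma with $j^m_p$ the unique $\circ^m_p$-inverse. An $(\infty,0)$-categorical stretching consists of an $(\infty,0)$-magma $M$, a strict $(\infty,0)$-category $C$, a morphism $\pi:M\to C$ of $(\infty,0)$-magmas, and, for all $m\ge 0$ and all parallel $m$-cells $c_1,c_0$ of $M$ with $\pi(c_1)=\pi(c_0)$, an $(m+1)$-cell $[c_1,c_0]_m$ of $M$ with target $c_1$, source $c_0$, $\pi([c_1,c_0]_m)=1^m_{m+1}(\pi(c_1))$ and $[c,c]_m=1^m_{m+1}(c)$. Morphisms of stretchings are commutative squares of $(\infty,0)$-magma morphisms that preserve the brackets. The functor $(M,C,\pi,[-,-])\mapsto M$ to $\infty$-graphs has a left adjoint; let $\mathbb T^{(\infty,0)}$ be the induced monad. For an $\infty$-graph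 $G$ let $\pi_G:M(G)\to C(G)$ be the free stretching, so that $\mathbb T^{(\infty,0)}(G)=M(G)$ as $\infty$-graphs, and let $\lambda:G\to M(G)$ be the unit. A $\mathbb T^{(\infty,0)}$-algebra $(G,v)$, with $v:M(G)\to G$, carries the canonical $(\infty,0)$-magma structure generated by $\iota^m_{m+1}(a)=v(1^m_{m+1}(\lambda a))$, $a\circ^m_p b=v(\lambda a\star^m_p\lambda b)$ and $i^m_p(a)=v(j^m_p(\lambda a))$. It has dimension $d$ if every $q$-cell of $G$ with $q>d$ is an identity cell ($\iota^p_q(x)$ for some $p<q$ and some $x$), and some $d$-cell is not an identity cell. A $1$-cell $f:a\to b$ is an equivalence if there are a $1$-cell $g:b\to a$ and $\circ^2_1$-invertible $2$-cells $f\circ^1_0g\Rightarrow\iota^0_1(b)$ and $g\circ^1_0f\Rightarrow\iota^0_1(a)$. **Proposition.** Let $(G,v)$ be a $\mathbb T^{(\infty,0)}$-algebra of dimension $2$ and let $f:a\to b$ be a $1$-cell of $G$. Then $f$ is an equivalence. More precisely, in $M(G)$ the coherence cells $$\beta=\bigl[\,1^0_1(\lambda b),\ \lambda f\star^1_0 j^1_0(\lambda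 f)\,\bigr]_1,\qquad \alpha=\bigl[\,1^0_1(\lambda a),\ j^1_0(\lambda f)\star^1_0\lambda f\,\bigr]_1$$ are defined (the pairs are parallel and have equal images under $\pi_G$), and their images are $2$-cells of $G$ $$v(\beta): f\circ^1_0 i^1_0(f)\Rightarrow\iota^0_1(b),\qquad v(\alpha): i^1_0(f)\circ^1_0 f\Rightarrow\iota^0_1(a),$$ which are $\circ^2_1$-invertible, with $\circ^2_1$-inverses $i^2_1(v(\beta))$ and $i^2_1(v(\alpha))$ respectively. -/

import Mathlib

open CategoryTheory

universe u

noncomputable section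

/-! ## Globular sets -/

/-- An `∞`-graph (globular set), i.e. a presheaf of sets on the globe category. -/
structure InftyGraph where
  cell : ℕ → Type u
  s : ∀ {m : ℕ}, cell (m + 1) → cell m
  t : ∀ {m : ℕ}, cell (m + 1) → cell m
  s_s : ∀ {m : ℕ} (x : cell (m + 2)), s (s x) = s (t x)
  t_t : ∀ {m : ℕ} (x : cell (m + 2)), t (t x) = t (s x)

namespace InftyGraph

/-- A morphism of `∞`-graphs. -/
@[ext]
structure Hom (X Y : InftyGraph.{u}) where
  app : ∀ {m : ℕ}, X.cell m → Y.cell m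
  map_s : ∀ {m : ℕ} (x : X.cell (m + 1)), app (X.s x) = Y.s (app x)
  map_t : ∀ {m : ℕ} (x : X.cell (m + 1)), app (X.t x) = Y.t (app x)

/-- The category of `∞`-graphs. -/
instance : Category InftyGraph.{u} where
  Hom := Hom
  id X := { app := fun x => x, map_s := fun _ => rfl, map_t := fun _ => rfl }
  comp f g :=
    { app := fun x => g.app (f.app x)
      map_s := fun x => by rw [f.map_s, g.map_s]
      map_t := fun x => by rw [f.map_t, g.map_t] }

/-- The iterated source `s^m_p : X_m → X_p` for `p ≤ m` (the identity for `p = m`). -/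
def src (X : InftyGraph.{u}) {p m : ℕ} (h : p ≤ m) (x : X.cell m) : X.cell p :=
  Nat.decreasingInduction (motive := fun k _ => X.cell k) (fun _ _ y => X.s y) x h

/-- The iterated target `t^m_p : X_m → X_p` for `p ≤ m` (the identity for `p = m`). -/
def tgt (X : InftyGraph.{u}) {p m : ℕ} (h : p ≤ m) (x : X.cell m) : X.cell p :=
  Nat.decreasingInduction (motive := fun k _ => X.cell k) (fun _ _ y => X.t y) x h

/-- The pair of `m`-cells `(y, x)` is `∘^m_p`-composable: `s^m_p y = t^m_p x`. -/
def Composable (X : InftyGraph.{u}) {p m : ℕ} (h : p ≤ m) (y x : X.cell m) : Prop :=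
  X.src h y = X.tgt h x

/-- Two `m`-cells are parallel if they have the same source and the same target
(any two `0`-cells are parallel). -/
def Parallel (X : InftyGraph.{u}) : ∀ {m : ℕ}, X.cell m → X.cell m → Prop
  | 0, _, _ => True
  | _ + 1, x, y => X.t x = X.t y ∧ X.s x = X.s y

theorem src_self (X : InftyGraph.{u}) {m : ℕ} (x : X.cell m) : X.src le_rfl x = x :=
  Nat.decreasingInduction_self _ _

theorem tgt_self (X : InftyGraph.{u}) {m : ℕ} (x : X.cell m) : X.tgt le_rfl x = x :=
  Nat.decreasingInduction_self _ _

theorem src_succ (X : InftyGraph.{u}) {p m : ℕ} (h : p ≤ m) (h' : p ≤ m + 1)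
    (x : X.cell (m + 1)) : X.src h' x = X.src h (X.s x) :=
  Nat.decreasingInduction_succ (motive := fun k _ => X.cell k) _ _ h h'

theorem tgt_succ (X : InftyGraph.{u}) {p m : ℕ} (h : p ≤ m) (h' : p ≤ m + 1)
    (x : X.cell (m + 1)) : X.tgt h' x = X.tgt h (X.t x) :=
  Nat.decreasingInduction_succ (motive := fun k _ => X.cell k) _ _ h h'

theorem Hom.map_src {X Y : InftyGraph.{u}} (f : Hom X Y) {p m : ℕ} (h : p ≤ m) (x : X.cell m) :
    f.app (X.src h x) = Y.src h (f.app x) := by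
  induction m, h using Nat.le_induction with
  | base => rw [src_self, src_self]
  | succ m h ih => rw [X.src_succ h, Y.src_succ h, ih, f.map_s]

theorem Hom.map_tgt {X Y : InftyGraph.{u}} (f : Hom X Y) {p m : ℕ} (h : p ≤ m) (x : X.cell m) :
    f.app (X.tgt h x) = Y.tgt h (f.app x) := by
  induction m, h using Nat.le_induction with
  | base => rw [tgt_self, tgt_self]
  | succ m h ih => rw [X.tgt_succ h, Y.tgt_succ h, ih, f.map_t]

theorem Composable.map {X Y : InftyGraph.{u}} (f : Hom X Y) {p m : ℕ} {h : p ≤ m}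
    {y x : X.cell m} (hc : X.Composable h y x) : Y.Composable h (f.app y) (f.app x) := by
  unfold Composable at *
  rw [← f.map_src, ← f.map_tgt, hc]

theorem Parallel.map {X Y : InftyGraph.{u}} (f : Hom X Y) {m : ℕ}
    {y x : X.cell m} (hc : X.Parallel y x) : Y.Parallel (f.app y) (f.app x) := by
  cases m with
  | zero => trivial
  | succ m => exact ⟨by rw [← f.map_t, ← f.map_t, hc.1], by rw [← f.map_s, ← f.map_s, hc.2]⟩

theorem src_t (X : InftyGraph.{u}) {p m : ℕ} (h : p < m) (x : X.cell (m + 1)) :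
    X.src h.le (X.t x) = X.src h.le (X.s x) := by
  obtain ⟨k, rfl⟩ : ∃ k, m = k + 1 := ⟨m - 1, by omega⟩
  rw [X.src_succ (Nat.lt_succ_iff.1 h), X.src_succ (Nat.lt_succ_iff.1 h), X.s_s]

theorem tgt_s (X : InftyGraph.{u}) {p m : ℕ} (h : p < m) (x : X.cell (m + 1)) :
    X.tgt h.le (X.s x) = X.tgt h.le (X.t x) := by
  obtain ⟨k, rfl⟩ : ∃ k, m = k + 1 := ⟨m - 1, by omega⟩
  rw [X.tgt_succ (Nat.lt_succ_iff.1 h), X.tgt_succ (Nat.lt_succ_iff.1 h), X.t_t]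

theorem Composable.s {X : InftyGraph.{u}} {p m : ℕ} (h : p < m) {h' : p ≤ m + 1}
    {y x : X.cell (m + 1)} (hc : X.Composable h' y x) :
    X.Composable h.le (X.s y) (X.s x) := by
  unfold Composable at *
  rw [X.tgt_s h, ← X.src_succ h.le h', ← X.tgt_succ h.le h', hc]

theorem Composable.t {X : InftyGraph.{u}} {p m : ℕ} (h : p < m) {h' : p ≤ m + 1}
    {y x : X.cell (m + 1)} (hc : X.Composable h' y x) :
    X.Composable h.le (X.t y) (X.t x) := by
  unfold Composable at *
  rw [X.src_t h, ← X.src_succ h.le h', ← X.tgt_succ h.le h', hc]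

theorem composable_of_s_eq_t (X : InftyGraph.{u}) {m : ℕ} {y x : X.cell (m + 1)}
    (h : X.s y = X.t x) : X.Composable (Nat.le_succ m) y x := by
  unfold Composable
  rw [X.src_succ le_rfl, X.tgt_succ le_rfl, src_self, tgt_self, h]

theorem Composable.s_eq_t {X : InftyGraph.{u}} {m : ℕ} {h : m ≤ m + 1} {y x : X.cell (m + 1)}
    (hc : X.Composable h y x) : X.s y = X.t x := by
  unfold Composable at hc
  rwa [X.src_succ le_rfl, X.tgt_succ le_rfl, src_self, tgt_self] at hc

end InftyGraph

/-! ## Reflexive `∞`-graphs and their dimension -/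

/-- A reflexive `∞`-graph: an `∞`-graph with reflexors `1^m_{m+1}`. -/
structure ReflInftyGraph extends InftyGraph.{u} where
  one : ∀ {m : ℕ}, cell m → cell (m + 1)
  s_one : ∀ {m : ℕ} (x : cell m), s (one x) = x
  t_one : ∀ {m : ℕ} (x : cell m), t (one x) = x

namespace ReflInftyGraph

/-- The iterated reflexor `1^p_m : X_p → X_m` for `p ≤ m` (the identity for `p = m`). -/
def ones (X : ReflInftyGraph.{u}) {p m : ℕ} (h : p ≤ m) (x : X.cell p) : X.cell m :=
  Nat.leRec (motive := fun k _ => X.cell k) x (fun _ _ y => X.one y) h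

/-- A `q`-cell is an identity cell if it is `1^p_q x` for some `p < q` and some `p`-cell `x`. -/
def IsIdentity (X : ReflInftyGraph.{u}) {q : ℕ} (x : X.cell q) : Prop :=
  ∃ (p : ℕ) (h : p < q) (y : X.cell p), X.ones h.le y = x

/-- A reflexive `∞`-graph has dimension `d` if all its `q`-cells with `q > d` are identity cells
and at least one `d`-cell is not an identity cell. -/
def HasDimension (X : ReflInftyGraph.{u}) (d : ℕ) : Prop :=
  (∀ q : ℕ, d < q → ∀ x : X.cell q, X.IsIdentity x) ∧ ∃ x : X.cell d, ¬ X.IsIdentity x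

theorem ones_self (X : ReflInftyGraph.{u}) {m : ℕ} (x : X.cell m) : X.ones le_rfl x = x :=
  Nat.leRec_self _ _

theorem ones_succ (X : ReflInftyGraph.{u}) {p m : ℕ} (h : p ≤ m) (h' : p ≤ m + 1)
    (x : X.cell p) : X.ones h' x = X.one (X.ones h x) :=
  Nat.leRec_succ (motive := fun k _ => X.cell k) _ _ h

end ReflInftyGraph

/-! ## Magmas -/

/-- An `∞`-magma: a reflexive `∞`-graph with compositions `y ∘^m_p x`, defined when
`s^m_p y = t^m_p x`, which satisfy the positional axioms. These are stated for one step down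
in dimension; iterating them gives the sources and targets in all lower dimensions. The proofs of
composability on the right-hand sides always exist, by `InftyGraph.Composable.s` and
`InftyGraph.Composable.t`. -/
structure InftyMagma extends ReflInftyGraph.{u} where
  comp : ∀ {p m : ℕ} (hp : p < m) (y x : cell m), toInftyGraph.Composable hp.le y x → cell m
  s_comp_top : ∀ {m : ℕ} (y x : cell (m + 1)) (h : toInftyGraph.Composable m.le_succ y x),
    s (comp m.lt_succ_self y x h) = s x
  t_comp_top : ∀ {m : ℕ} (y x : cell (m + 1)) (h : toInftyGraph.Composable m.le_succ y x),
    t (comp m.lt_succ_self y x h) = t y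
  s_comp : ∀ {p m : ℕ} (hp : p < m) (y x : cell (m + 1))
    (h : toInftyGraph.Composable (hp.trans m.lt_succ_self).le y x)
    (h' : toInftyGraph.Composable hp.le (s y) (s x)),
    s (comp (hp.trans m.lt_succ_self) y x h) = comp hp (s y) (s x) h'
  t_comp : ∀ {p m : ℕ} (hp : p < m) (y x : cell (m + 1))
    (h : toInftyGraph.Composable (hp.trans m.lt_succ_self).le y x)
    (h' : toInftyGraph.Composable hp.le (t y) (t x)),
    t (comp (hp.trans m.lt_succ_self) y x h) = comp hp (t y) (t x) h'

namespace InftyMagma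

/-- `β` is a `∘^m_p`-inverse of `α`:
`α ∘^m_p β = 1^p_m (t^m_p α)` and `β ∘^m_p α = 1^p_m (s^m_p α)`. -/
def IsInverse (X : InftyMagma.{u}) {p m : ℕ} (hp : p < m) (α β : X.cell m) : Prop :=
  (∃ h : X.Composable hp.le α β, X.comp hp α β h = X.ones hp.le (X.tgt hp.le α)) ∧
  (∃ h : X.Composable hp.le β α, X.comp hp β α h = X.ones hp.le (X.src hp.le α))

/-- `α` is `∘^m_p`-invertible. -/
def IsInvertible (X : InftyMagma.{u}) {p m : ℕ} (hp : p < m) (α : X.cell m) : Prop :=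
  ∃ β : X.cell m, X.IsInverse hp α β

/-- A `1`-cell `f : a ⟶ b` is an equivalence if there are a `1`-cell `g : b ⟶ a` and
`∘^2_1`-invertible `2`-cells `f ∘ g ⟹ 1_b` and `g ∘ f ⟹ 1_a`. -/
def IsEquivalence (X : InftyMagma.{u}) (f : X.cell 1) : Prop :=
  ∃ (g : X.cell 1) (h : X.Composable zero_le_one f g) (h' : X.Composable zero_le_one g f)
    (β α : X.cell 2),
    X.s β = X.comp zero_lt_one f g h ∧ X.t β = X.one (X.t f) ∧
    X.s α = X.comp zero_lt_one g f h' ∧ X.t α = X.one (X.s f) ∧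
    X.IsInvertible one_lt_two β ∧ X.IsInvertible one_lt_two α

/-- The axioms of a strict `∞`-category: associativity, units, interchange, and compatibility
of the reflexors with the compositions. All the composability proofs that are quantified over
exist as soon as the first ones do, by the positional axioms and globularity. -/
structure IsStrict (X : InftyMagma.{u}) : Prop where
  assoc : ∀ {p m : ℕ} (hp : p < m) (z y x : X.cell m) (hzy : X.Composable hp.le z y)
    (hyx : X.Composable hp.le y x) (h₁ : X.Composable hp.le (X.comp hp z y hzy) x)
    (h₂ : X.Composable hp.le z (X.comp hp y x hyx)),
    X.comp hp (X.comp hp z y hzy) x h₁ = X.comp hp z (X.comp hp y x hyx) h₂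
  comp_one : ∀ {p m : ℕ} (hp : p < m) (x : X.cell m)
    (h : X.Composable hp.le x (X.ones hp.le (X.src hp.le x))),
    X.comp hp x (X.ones hp.le (X.src hp.le x)) h = x
  one_comp : ∀ {p m : ℕ} (hp : p < m) (x : X.cell m)
    (h : X.Composable hp.le (X.ones hp.le (X.tgt hp.le x)) x),
    X.comp hp (X.ones hp.le (X.tgt hp.le x)) x h = x
  interchange : ∀ {q p m : ℕ} (hq : q < p) (hp : p < m) (y' y x' x : X.cell m)
    (hy : X.Composable hp.le y' y) (hx : X.Composable hp.le x' x)
    (h' : X.Composable (hq.trans hp).le y' x') (h : X.Composable (hq.trans hp).le y x)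
    (h₁ : X.Composable (hq.trans hp).le (X.comp hp y' y hy) (X.comp hp x' x hx))
    (h₂ : X.Composable hp.le (X.comp (hq.trans hp) y' x' h') (X.comp (hq.trans hp) y x h)),
    X.comp (hq.trans hp) (X.comp hp y' y hy) (X.comp hp x' x hx) h₁ =
      X.comp hp (X.comp (hq.trans hp) y' x' h') (X.comp (hq.trans hp) y x h) h₂
  ones_comp : ∀ {q p m : ℕ} (hq : q < p) (hp : p < m) (y x : X.cell p)
    (h : X.Composable hq.le y x)
    (h' : X.Composable (hq.trans hp).le (X.ones hp.le y) (X.ones hp.le x)),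
    X.ones hp.le (X.comp hq y x h) =
      X.comp (hq.trans hp) (X.ones hp.le y) (X.ones hp.le x) h'

end InftyMagma

/-- An `(∞, n)`-magma: an `∞`-magma whose underlying `∞`-graph is equipped with reversors `j^m_p`,
`n ≤ p < m`. The reversor `j^{p+1}_p` exchanges sources and targets; for `p < m` the reversors
`j^{m+1}_p` and `j^m_p` commute with the sources and the targets. -/
structure InftyNMagma (n : ℕ) extends InftyMagma.{u} where
  rev : ∀ {p m : ℕ}, n ≤ p → p < m → cell m → cell m
  s_rev_top : ∀ {p : ℕ} (hn : n ≤ p) (x : cell (p + 1)), s (rev hn p.lt_succ_self x) = t x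
  t_rev_top : ∀ {p : ℕ} (hn : n ≤ p) (x : cell (p + 1)), t (rev hn p.lt_succ_self x) = s x
  s_rev : ∀ {p m : ℕ} (hn : n ≤ p) (hp : p < m) (x : cell (m + 1)),
    s (rev hn (hp.trans m.lt_succ_self) x) = rev hn hp (s x)
  t_rev : ∀ {p m : ℕ} (hn : n ≤ p) (hp : p < m) (x : cell (m + 1)),
    t (rev hn (hp.trans m.lt_succ_self) x) = rev hn hp (t x)

namespace InftyNMagma

variable {n : ℕ}

/-- A strict `(∞, n)`-category, seen as an `(∞, n)`-magma: a strict `∞`-category such that each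
`m`-cell `x` has a `∘^m_p`-inverse for all `n ≤ p < m`, with its canonical reversors, i.e. `j^m_p x`
is the (unique) `∘^m_p`-inverse of `x`. -/
structure IsStrict (X : InftyNMagma.{u} n) : Prop extends X.toInftyMagma.IsStrict where
  isInverse_rev : ∀ {p m : ℕ} (hn : n ≤ p) (hp : p < m) (x : X.cell m),
    X.toInftyMagma.IsInverse hp x (X.rev hn hp x)

/-- A morphism of `(∞, n)`-magmas. -/
structure Hom (X Y : InftyNMagma.{u} n) extends
    InftyGraph.Hom X.toInftyGraph Y.toInftyGraph where
  map_one : ∀ {m : ℕ} (x : X.cell m), app (X.one x) = Y.one (app x)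
  map_comp : ∀ {p m : ℕ} (hp : p < m) (y x : X.cell m) (h : X.Composable hp.le y x),
    app (X.comp hp y x h) = Y.comp hp (app y) (app x) (h.map toHom)
  map_rev : ∀ {p m : ℕ} (hn : n ≤ p) (hp : p < m) (x : X.cell m),
    app (X.rev hn hp x) = Y.rev hn hp (app x)

theorem Hom.ext' {X Y : InftyNMagma.{u} n} {f g : Hom X Y}
    (h : ∀ (m : ℕ) (x : X.cell m), f.app x = g.app x) : f = g := by
  obtain ⟨⟨f, _, _⟩, _, _, _⟩ := f
  obtain ⟨⟨g, _, _⟩, _, _, _⟩ := g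
  obtain rfl : @f = @g := by
    funext m x
    exact h m x
  rfl

/-- The category of `(∞, n)`-magmas. -/
instance : Category (InftyNMagma.{u} n) where
  Hom := Hom
  id X :=
    { app := fun x => x
      map_s := fun _ => rfl
      map_t := fun _ => rfl
      map_one := fun _ => rfl
      map_comp := fun _ _ _ _ => rfl
      map_rev := fun _ _ _ => rfl }
  comp f g :=
    { app := fun x => g.app (f.app x)
      map_s := fun x => by rw [f.map_s, g.map_s]
      map_t := fun x => by rw [f.map_t, g.map_t]
      map_one := fun x => by rw [f.map_one, g.map_one]
      map_comp := fun hp y x h => by rw [f.map_comp, g.map_comp]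
      map_rev := fun hn hp x => by rw [f.map_rev, g.map_rev] }

end InftyNMagma

/-! ## Stretchings -/

/-- An `(∞, n)`-categorical stretching: a morphism `π : M ⟶ C` from an `(∞, n)`-magma to a strict
`(∞, n)`-category, with a coherence cell `[c₁, c₀] : c₀ ⟶ c₁` for every pair of parallel cells
of `M` such that `π c₁ = π c₀`. -/
structure Stretching (n : ℕ) where
  M : InftyNMagma.{u} n
  C : InftyNMagma.{u} n
  strict : C.IsStrict
  π : InftyNMagma.Hom M C
  br : ∀ {m : ℕ} (c₁ c₀ : M.cell m), M.Parallel c₁ c₀ → π.app c₁ = π.app c₀ → M.cell (m + 1)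
  t_br : ∀ {m : ℕ} (c₁ c₀ : M.cell m) (h : M.Parallel c₁ c₀) (h' : π.app c₁ = π.app c₀),
    M.t (br c₁ c₀ h h') = c₁
  s_br : ∀ {m : ℕ} (c₁ c₀ : M.cell m) (h : M.Parallel c₁ c₀) (h' : π.app c₁ = π.app c₀),
    M.s (br c₁ c₀ h h') = c₀
  π_br : ∀ {m : ℕ} (c₁ c₀ : M.cell m) (h : M.Parallel c₁ c₀) (h' : π.app c₁ = π.app c₀),
    π.app (br c₁ c₀ h h') = C.one (π.app c₁)
  br_self : ∀ {m : ℕ} (c : M.cell m) (h : M.Parallel c c) (h' : π.app c = π.app c),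
    br c c h h' = M.one c

namespace Stretching

variable {n : ℕ}

/-- A morphism of `(∞, n)`-categorical stretchings. -/
structure Hom (E E' : Stretching.{u} n) where
  onM : InftyNMagma.Hom E.M E'.M
  onC : InftyNMagma.Hom E.C E'.C
  comm : ∀ {m : ℕ} (x : E.M.cell m), E'.π.app (onM.app x) = onC.app (E.π.app x)
  map_br : ∀ {m : ℕ} (c₁ c₀ : E.M.cell m) (h : E.M.Parallel c₁ c₀)
    (h' : E.π.app c₁ = E.π.app c₀),
    onM.app (E.br c₁ c₀ h h') = E'.br (onM.app c₁) (onM.app c₀) (h.map onM.toHom)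
      (by rw [comm, comm, h'])

theorem Hom.ext' {E E' : Stretching.{u} n} {f g : Hom E E'}
    (h : ∀ (m : ℕ) (x : E.M.cell m), f.onM.app x = g.onM.app x)
    (h' : ∀ (m : ℕ) (x : E.C.cell m), f.onC.app x = g.onC.app x) : f = g := by
  obtain ⟨f, f', _, _⟩ := f
  obtain ⟨g, g', _, _⟩ := g
  obtain rfl : f = g := InftyNMagma.Hom.ext' h
  obtain rfl : f' = g' := InftyNMagma.Hom.ext' h'
  rfl

/-- The category of `(∞, n)`-categorical stretchings. -/
instance : Category (Stretching.{u} n) where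
  Hom := Hom
  id E :=
    { onM := 𝟙 E.M
      onC := 𝟙 E.C
      comm := fun _ => rfl
      map_br := fun _ _ _ _ => rfl }
  comp {E E' E''} f g :=
    { onM := (show E.M ⟶ E'.M from f.onM) ≫ (show E'.M ⟶ E''.M from g.onM)
      onC := (show E.C ⟶ E'.C from f.onC) ≫ (show E'.C ⟶ E''.C from g.onC)
      comm := fun x => by
        change E''.π.app (g.onM.app (f.onM.app x)) = g.onC.app (f.onC.app (E.π.app x))
        rw [g.comm, f.comm]
      map_br := fun c₁ c₀ h h' => by
        change g.onM.app (f.onM.app _) = _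
        rw [f.map_br, g.map_br]
        rfl }

end Stretching

/-- The forgetful functor `U_n : (M, C, π, [-,-]) ↦ M` from `(∞, n)`-categorical stretchings to
`∞`-graphs. -/
def forgetStretching (n : ℕ) : Stretching.{u} n ⥤ InftyGraph.{u} where
  obj E := E.M.toInftyGraph
  map f := (Stretching.Hom.onM f).toHom

/-! ## The free stretching on an `∞`-graph

The left adjoint of `forgetStretching n` is obtained from initial objects: the cells of the free
stretching on `G` are the formal expressions in the cells of `G` that can be evaluated in every
stretching under `G`, two expressions being identified when they always have the same value. -/

namespace FreeStretching

/-- Formal expressions, for the `M`-part (`false`) and for the `C`-part (`true`). -/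
inductive Term (n : ℕ) (G : InftyGraph.{u}) : Bool → ℕ → Type u
  | gen {m : ℕ} : G.cell m → Term n G false m
  | s {b : Bool} {m : ℕ} : Term n G b (m + 1) → Term n G b m
  | t {b : Bool} {m : ℕ} : Term n G b (m + 1) → Term n G b m
  | one {b : Bool} {m : ℕ} : Term n G b m → Term n G b (m + 1)
  | comp {b : Bool} {p m : ℕ} : p < m → Term n G b m → Term n G b m → Term n G b m
  | rev {b : Bool} {p m : ℕ} : n ≤ p → p < m → Term n G b m → Term n G b m
  | pi {m : ℕ} : Term n G false m → Term n G true m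
  | br {m : ℕ} : Term n G false m → Term n G false m → Term n G false (m + 1)

variable (n : ℕ) (G : InftyGraph.{u})

/-- The stretchings under `G`. -/
abbrev Under : Type (u + 1) := Σ E : Stretching.{u} n, InftyGraph.Hom G E.M.toInftyGraph

variable {n G}

/-- The two magmas of a stretching. -/
@[reducible]
def Under.mag (i : Under n G) : Bool → InftyNMagma.{u} n
  | false => i.1.M
  | true => i.1.C

/-- The expression has the given value in the stretching `i` under `G`. -/
def Ev (i : Under n G) : ∀ {b : Bool} {m : ℕ}, Term n G b m → (i.mag b).cell m → Prop
  | _, _, .gen g, x => x = i.2.app g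
  | _, _, .s a, x => ∃ y, Ev i a y ∧ x = (i.mag _).s y
  | _, _, .t a, x => ∃ y, Ev i a y ∧ x = (i.mag _).t y
  | _, _, .one a, x => ∃ y, Ev i a y ∧ x = (i.mag _).one y
  | _, _, .comp hp a a', x => ∃ y y' h, Ev i a y ∧ Ev i a' y' ∧ x = (i.mag _).comp hp y y' h
  | _, _, .rev hn hp a, x => ∃ y, Ev i a y ∧ x = (i.mag _).rev hn hp y
  | _, _, .pi a, x => ∃ y, Ev i a y ∧ x = i.1.π.app y
  | _, _, .br a a', x => ∃ y y' h h', Ev i a y ∧ Ev i a' y' ∧ x = i.1.br y y' h h'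

theorem Ev.unique (i : Under n G) {b : Bool} {m : ℕ} (a : Term n G b m) :
    ∀ {x x' : (i.mag b).cell m}, Ev i a x → Ev i a x' → x = x' := by
  induction a with
  | gen g => exact fun h h' => h.trans h'.symm
  | s a ih | t a ih | one a ih | rev _ _ a ih | pi a ih =>
    rintro _ _ ⟨y, hy, rfl⟩ ⟨y', hy', rfl⟩
    obtain rfl := ih hy hy'
    rfl
  | comp _ a b iha ihb =>
    rintro _ _ ⟨y, z, _, hy, hz, rfl⟩ ⟨y', z', _, hy', hz', rfl⟩
    obtain rfl := iha hy hy'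
    obtain rfl := ihb hz hz'
    rfl
  | br a b iha ihb =>
    rintro _ _ ⟨y, z, _, _, hy, hz, rfl⟩ ⟨y', z', _, _, hy', hz', rfl⟩
    obtain rfl := iha hy hy'
    obtain rfl := ihb hz hz'
    rfl

variable (n G)

/-- The families of values of the expressions that have a value everywhere. -/
def Fam (b : Bool) (m : ℕ) : Type (u + 1) :=
  { f : ∀ i : Under n G, (i.mag b).cell m // ∃ a : Term n G b m, ∀ i, Ev i a (f i) }

instance (b : Bool) (m : ℕ) : Small.{u} (Fam n G b m) := by
  let T := { a : Term n G b m // ∃ f : ∀ i : Under n G, (i.mag b).cell m, ∀ i, Ev i a (f i) }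
  let φ : T → Fam n G b m := fun a => ⟨a.2.choose, a.1, a.2.choose_spec⟩
  have hφ : Function.Surjective φ := by
    rintro ⟨f, a, ha⟩
    refine ⟨⟨a, f, ha⟩, Subtype.ext ?_⟩
    funext i
    exact Ev.unique i a ((⟨a, f, ha⟩ : T).2.choose_spec i) (ha i)
  exact small_of_surjective hφ

/-- The cells of the free stretching. -/
def Cell (b : Bool) (m : ℕ) : Type u := Shrink.{u} (Fam n G b m)

variable {n G}

/-- The value of a cell of the free stretching in a stretching under `G`. -/
def val {b : Bool} {m : ℕ} (x : Cell n G b m) (i : Under n G) : (i.mag b).cell m :=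
  ((equivShrink (Fam n G b m)).symm x).1 i

/-- The cell of the free stretching with the given values. -/
def mk {b : Bool} {m : ℕ} (f : ∀ i : Under n G, (i.mag b).cell m)
    (h : ∃ a : Term n G b m, ∀ i, Ev i a (f i)) : Cell n G b m :=
  equivShrink (Fam n G b m) ⟨f, h⟩

@[simp]
theorem val_mk {b : Bool} {m : ℕ} (f : ∀ i : Under n G, (i.mag b).cell m)
    (h : ∃ a : Term n G b m, ∀ i, Ev i a (f i)) (i : Under n G) : val (mk f h) i = f i := by
  have e : (equivShrink (Fam n G b m)).symm (mk f h) = ⟨f, h⟩ := Equiv.symm_apply_apply _ _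
  exact congrFun (congrArg Subtype.val e) i

theorem ex_val {b : Bool} {m : ℕ} (x : Cell n G b m) :
    ∃ a : Term n G b m, ∀ i, Ev i a (val x i) :=
  ((equivShrink (Fam n G b m)).symm x).2

theorem val_ext {b : Bool} {m : ℕ} {x y : Cell n G b m} (h : ∀ i, val x i = val y i) : x = y :=
  (equivShrink (Fam n G b m)).symm.injective (Subtype.ext (funext h))

variable (n G)

/-- The underlying `∞`-graphs of the free stretching. -/
abbrev graph (b : Bool) : InftyGraph.{u} where
  cell m := Cell n G b m
  s x := mk (fun i => (i.mag b).s (val x i)) <| by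
    obtain ⟨a, ha⟩ := ex_val x
    exact ⟨.s a, fun i => ⟨_, ha i, rfl⟩⟩
  t x := mk (fun i => (i.mag b).t (val x i)) <| by
    obtain ⟨a, ha⟩ := ex_val x
    exact ⟨.t a, fun i => ⟨_, ha i, rfl⟩⟩
  s_s x := val_ext fun i => by simp [InftyGraph.s_s]
  t_t x := val_ext fun i => by simp [InftyGraph.t_t]

variable {n G}

/-- Evaluation as a morphism of `∞`-graphs. -/
def valGraph (b : Bool) (i : Under n G) :
    InftyGraph.Hom (graph n G b) (i.mag b).toInftyGraph where
  app x := val x i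
  map_s _ := val_mk _ _ i
  map_t _ := val_mk _ _ i

theorem composable_iff {b : Bool} {p m : ℕ} {h : p ≤ m} {y x : Cell n G b m} :
    (graph n G b).Composable h y x ↔
      ∀ i : Under n G, (i.mag b).Composable h (val y i) (val x i) := by
  refine ⟨fun hc i => hc.map (valGraph b i), fun hc => val_ext fun i => ?_⟩
  exact ((valGraph b i).map_src h y).trans ((hc i).trans ((valGraph b i).map_tgt h x).symm)

variable (n G)

/-- The underlying reflexive `∞`-graphs of the free stretching. -/
abbrev refl (b : Bool) : ReflInftyGraph.{u} where
  toInftyGraph := graph n G b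
  one x := mk (fun i => (i.mag b).one (val x i)) <| by
    obtain ⟨a, ha⟩ := ex_val x
    exact ⟨.one a, fun i => ⟨_, ha i, rfl⟩⟩
  s_one x := val_ext fun i =>
    (val_mk _ _ i).trans ((congrArg _ (val_mk _ _ i)).trans ((i.mag b).s_one _))
  t_one x := val_ext fun i =>
    (val_mk _ _ i).trans ((congrArg _ (val_mk _ _ i)).trans ((i.mag b).t_one _))

/-- Composition in the free stretching. -/
def fcomp {b : Bool} {p m : ℕ} (hp : p < m) (y x : Cell n G b m)
    (h : (graph n G b).Composable hp.le y x) : Cell n G b m :=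
  mk (fun i => (i.mag b).comp hp (val y i) (val x i) (composable_iff.1 h i)) <| by
    obtain ⟨a, ha⟩ := ex_val y
    obtain ⟨a', ha'⟩ := ex_val x
    exact ⟨.comp hp a a', fun i => ⟨_, _, _, ha i, ha' i, rfl⟩⟩

/-- Reversors in the free stretching. -/
def frev {b : Bool} {p m : ℕ} (hn : n ≤ p) (hp : p < m) (x : Cell n G b m) : Cell n G b m :=
  mk (fun i => (i.mag b).rev hn hp (val x i)) <| by
    obtain ⟨a, ha⟩ := ex_val x
    exact ⟨.rev hn hp a, fun i => ⟨_, ha i, rfl⟩⟩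

variable {n G}

theorem val_s {b : Bool} {m : ℕ} (x : Cell n G b (m + 1)) (i : Under n G) :
    val ((graph n G b).s x) i = (i.mag b).s (val x i) := val_mk _ _ i

theorem val_t {b : Bool} {m : ℕ} (x : Cell n G b (m + 1)) (i : Under n G) :
    val ((graph n G b).t x) i = (i.mag b).t (val x i) := val_mk _ _ i

theorem val_one {b : Bool} {m : ℕ} (x : Cell n G b m) (i : Under n G) :
    val ((refl n G b).one x) i = (i.mag b).one (val x i) := val_mk _ _ i

theorem val_ones {b : Bool} {p m : ℕ} (h : p ≤ m) (x : Cell n G b p) (i : Under n G) :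
    val ((refl n G b).ones h x) i = (i.mag b).ones h (val x i) := by
  induction m, h using Nat.le_induction with
  | base =>
    refine (congrArg (fun y : Cell n G b p => val y i)
      (ReflInftyGraph.ones_self (refl n G b) x)).trans ?_
    exact (ReflInftyGraph.ones_self _ _).symm
  | succ m h ih =>
    refine (congrArg (fun y : Cell n G b (m + 1) => val y i)
      (ReflInftyGraph.ones_succ (refl n G b) h _ x)).trans ?_
    rw [ReflInftyGraph.ones_succ _ h, ← ih]
    exact val_one _ _

theorem val_src {b : Bool} {p m : ℕ} (h : p ≤ m) (x : Cell n G b m) (i : Under n G) :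
    val ((graph n G b).src h x) i = (i.mag b).src h (val x i) := (valGraph b i).map_src h x

theorem val_tgt {b : Bool} {p m : ℕ} (h : p ≤ m) (x : Cell n G b m) (i : Under n G) :
    val ((graph n G b).tgt h x) i = (i.mag b).tgt h (val x i) := (valGraph b i).map_tgt h x

theorem val_comp {b : Bool} {p m : ℕ} (hp : p < m) (y x : Cell n G b m)
    (h : (graph n G b).Composable hp.le y x) (i : Under n G) :
    val (fcomp n G hp y x h) i = (i.mag b).comp hp (val y i) (val x i) (composable_iff.1 h i) :=
  val_mk _ _ i

theorem val_rev {b : Bool} {p m : ℕ} (hn : n ≤ p) (hp : p < m) (x : Cell n G b m)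
    (i : Under n G) : val (frev n G hn hp x) i = (i.mag b).rev hn hp (val x i) :=
  val_mk _ _ i

/-- Compositions of equal cells are equal. -/
theorem comp_congr (X : InftyMagma.{u}) {p m : ℕ} (hp : p < m) {y y' x x' : X.cell m}
    (hy : y = y') (hx : x = x') (h : X.Composable hp.le y x) :
    X.comp hp y x h = X.comp hp y' x' (hy ▸ hx ▸ h) := by
  subst hy hx
  rfl

variable (n G)

/-- The underlying `∞`-magmas of the free stretching. -/
abbrev imag (b : Bool) : InftyMagma.{u} where
  toReflInftyGraph := refl n G b
  comp hp y x h := fcomp n G hp y x h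
  s_comp_top y x h := val_ext fun i => by
    refine (val_s _ i).trans ?_
    rw [val_comp]
    exact ((i.mag b).s_comp_top _ _ _).trans (val_s x i).symm
  t_comp_top y x h := val_ext fun i => by
    refine (val_t _ i).trans ?_
    rw [val_comp]
    exact ((i.mag b).t_comp_top _ _ _).trans (val_t y i).symm
  s_comp hp y x h h' := val_ext fun i => by
    refine (val_s _ i).trans ?_
    rw [val_comp, val_comp, (i.mag b).s_comp hp _ _ _ ((composable_iff.1 h i).s hp)]
    exact comp_congr _ _ (val_s _ _).symm (val_s _ _).symm _
  t_comp hp y x h h' := val_ext fun i => by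
    refine (val_t _ i).trans ?_
    rw [val_comp, val_comp, (i.mag b).t_comp hp _ _ _ ((composable_iff.1 h i).t hp)]
    exact comp_congr _ _ (val_t _ _).symm (val_t _ _).symm _

/-- The two `(∞, n)`-magmas of the free stretching. -/
abbrev nmag (b : Bool) : InftyNMagma.{u} n where
  toInftyMagma := imag n G b
  rev hn hp x := frev n G hn hp x
  s_rev_top hn x := val_ext fun i => by
    refine (val_s _ i).trans (Eq.trans ?_ (val_t _ i).symm)
    rw [val_rev, (i.mag b).s_rev_top]
  t_rev_top hn x := val_ext fun i => by
    refine (val_t _ i).trans (Eq.trans ?_ (val_s _ i).symm)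
    rw [val_rev, (i.mag b).t_rev_top]
  s_rev hn hp x := val_ext fun i => by
    refine (val_s _ i).trans ?_
    rw [val_rev, val_rev, (i.mag b).s_rev hn hp]
    exact congrArg _ (val_s _ i).symm
  t_rev hn hp x := val_ext fun i => by
    refine (val_t _ i).trans ?_
    rw [val_rev, val_rev, (i.mag b).t_rev hn hp]
    exact congrArg _ (val_t _ i).symm

variable {n G}

/-- Evaluation as a morphism of `(∞, n)`-magmas. -/
def valHom (b : Bool) (i : Under n G) : InftyNMagma.Hom (nmag n G b) (i.mag b) where
  toHom := valGraph b i
  map_one x := val_one x i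
  map_comp hp y x h := val_comp hp y x h i
  map_rev hn hp x := val_rev hn hp x i

theorem isStrict_nmag : (nmag n G true).IsStrict where
  assoc hp z y x hzy hyx h₁ h₂ := val_ext fun i => by
    have hs : i.1.C.IsStrict := i.1.strict
    refine (val_comp hp _ _ h₁ i).trans (Eq.trans ?_ (val_comp hp _ _ h₂ i).symm)
    refine (comp_congr _ hp (val_comp hp _ _ hzy i) rfl _).trans (Eq.trans ?_
      (comp_congr _ hp rfl (val_comp hp _ _ hyx i) _).symm)
    exact hs.assoc hp _ _ _ _ _ _ _
  comp_one hp x h := val_ext fun i => by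
    have hs : i.1.C.IsStrict := i.1.strict
    refine (val_comp hp _ _ h i).trans ?_
    refine (comp_congr _ hp rfl ((val_ones hp.le _ i).trans
      (congrArg _ (val_src hp.le x i))) _).trans ?_
    exact hs.comp_one hp _ _
  one_comp hp x h := val_ext fun i => by
    have hs : i.1.C.IsStrict := i.1.strict
    refine (val_comp hp _ _ h i).trans ?_
    refine (comp_congr _ hp ((val_ones hp.le _ i).trans
      (congrArg _ (val_tgt hp.le x i))) rfl _).trans ?_
    exact hs.one_comp hp _ _
  interchange hq hp y' y x' x hy hx h' h h₁ h₂ := val_ext fun i => by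
    have hs : i.1.C.IsStrict := i.1.strict
    refine (val_comp _ _ _ h₁ i).trans (Eq.trans ?_ (val_comp _ _ _ h₂ i).symm)
    refine (comp_congr _ _ (val_comp hp _ _ hy i) (val_comp hp _ _ hx i) _).trans (Eq.trans ?_
      (comp_congr _ hp (val_comp _ _ _ h' i) (val_comp _ _ _ h i) _).symm)
    exact hs.interchange hq hp _ _ _ _ _ _ _ _ _ _
  ones_comp hq hp y x h h' := val_ext fun i => by
    have hs : i.1.C.IsStrict := i.1.strict
    refine (val_ones hp.le _ i).trans (Eq.trans ?_ (val_comp _ _ _ h' i).symm)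
    refine (congrArg _ (val_comp hq _ _ h i)).trans (Eq.trans ?_
      (comp_congr _ _ (val_ones hp.le _ i) (val_ones hp.le _ i) _).symm)
    exact hs.ones_comp hq hp _ _ _ _
  isInverse_rev hn hp x := by
    have hs : ∀ i : Under n G, i.1.C.IsStrict := fun i => i.1.strict
    have h₁ : (graph n G true).Composable hp.le x (frev n G hn hp x) :=
      composable_iff.2 fun i => by
        rw [val_rev]
        exact ((hs i).isInverse_rev hn hp (val x i)).1.1
    have h₂ : (graph n G true).Composable hp.le (frev n G hn hp x) x :=
      composable_iff.2 fun i => by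
        rw [val_rev]
        exact ((hs i).isInverse_rev hn hp (val x i)).2.1
    refine ⟨⟨h₁, val_ext fun i => ?_⟩, ⟨h₂, val_ext fun i => ?_⟩⟩
    · refine (val_comp hp _ _ h₁ i).trans (Eq.trans ?_
        ((val_ones hp.le _ i).trans (congrArg _ (val_tgt hp.le x i))).symm)
      refine (comp_congr _ hp rfl (val_rev hn hp x i) _).trans ?_
      exact ((hs i).isInverse_rev hn hp (val x i)).1.2
    · refine (val_comp hp _ _ h₂ i).trans (Eq.trans ?_
        ((val_ones hp.le _ i).trans (congrArg _ (val_src hp.le x i))).symm)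
      refine (comp_congr _ hp (val_rev hn hp x i) rfl _).trans ?_
      exact ((hs i).isInverse_rev hn hp (val x i)).2.2

/-- The projection of the free stretching. -/
def fpi {m : ℕ} (x : Cell n G false m) : Cell n G true m :=
  mk (fun i => i.1.π.app (val x i)) <| by
    obtain ⟨a, ha⟩ := ex_val x
    exact ⟨.pi a, fun i => ⟨_, ha i, rfl⟩⟩

theorem val_fpi {m : ℕ} (x : Cell n G false m) (i : Under n G) :
    val (fpi x) i = i.1.π.app (val x i) := val_mk _ _ i

/-- The projection of the free stretching, as a morphism of `∞`-graphs. -/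
def piGraph : InftyGraph.Hom (graph n G false) (graph n G true) where
  app x := fpi x
  map_s x := val_ext fun i => by
    refine (val_fpi _ i).trans (Eq.trans ?_ (val_s _ i).symm)
    rw [val_fpi]
    exact (congrArg _ (val_s x i)).trans (i.1.π.map_s _)
  map_t x := val_ext fun i => by
    refine (val_fpi _ i).trans (Eq.trans ?_ (val_t _ i).symm)
    rw [val_fpi]
    exact (congrArg _ (val_t x i)).trans (i.1.π.map_t _)

/-- The projection of the free stretching, as a morphism. -/
def piHom : InftyNMagma.Hom (nmag n G false) (nmag n G true) where
  toHom := piGraph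
  map_one x := val_ext fun i => by
    refine (val_fpi _ i).trans (Eq.trans ?_ (val_one _ i).symm)
    refine (congrArg _ (val_one x i)).trans ((i.1.π.map_one _).trans ?_)
    exact congrArg _ (val_fpi x i).symm
  map_comp hp y x h := val_ext fun i => by
    refine (val_fpi _ i).trans (Eq.trans ?_ (val_comp hp (fpi y) (fpi x) (h.map piGraph) i).symm)
    refine (congrArg _ (val_comp hp y x h i)).trans ((i.1.π.map_comp hp _ _ _).trans ?_)
    exact comp_congr _ hp (val_fpi y i).symm (val_fpi x i).symm _
  map_rev hn hp x := val_ext fun i => by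
    refine (val_fpi _ i).trans (Eq.trans ?_ (val_rev _ _ _ i).symm)
    refine (congrArg _ (val_rev hn hp x i)).trans ((i.1.π.map_rev hn hp _).trans ?_)
    exact congrArg _ (val_fpi x i).symm

theorem π_val {m : ℕ} {x y : Cell n G false m} (h : fpi x = fpi y) (i : Under n G) :
    i.1.π.app (val x i) = i.1.π.app (val y i) := by
  rw [← val_fpi, ← val_fpi, h]

/-- The brackets of the free stretching. -/
def fbr {m : ℕ} (c₁ c₀ : Cell n G false m) (h : (graph n G false).Parallel c₁ c₀)
    (h' : fpi c₁ = fpi c₀) :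
    Cell n G false (m + 1) :=
  mk (fun i => i.1.br (val c₁ i) (val c₀ i) (h.map (valGraph false i)) (π_val h' i)) <| by
    obtain ⟨a, ha⟩ := ex_val c₁
    obtain ⟨a', ha'⟩ := ex_val c₀
    exact ⟨.br a a', fun i => ⟨_, _, _, _, ha i, ha' i, rfl⟩⟩

theorem val_fbr {m : ℕ} (c₁ c₀ : Cell n G false m) (h : (graph n G false).Parallel c₁ c₀)
    (h' : fpi c₁ = fpi c₀) (i : Under n G) : val (fbr c₁ c₀ h h') i =
      i.1.br (val c₁ i) (val c₀ i) (h.map (valGraph false i)) (π_val h' i) := val_mk _ _ i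

variable (n G)

/-- The free stretching on `G`. -/
def free : Stretching.{u} n where
  M := nmag n G false
  C := nmag n G true
  strict := isStrict_nmag
  π := piHom
  br c₁ c₀ h h' := fbr c₁ c₀ h h'
  t_br c₁ c₀ h h' := val_ext fun i => by
    refine (val_t _ i).trans ((congrArg _ (val_fbr c₁ c₀ h h' i)).trans ?_)
    exact i.1.t_br _ _ _ _
  s_br c₁ c₀ h h' := val_ext fun i => by
    refine (val_s _ i).trans ((congrArg _ (val_fbr c₁ c₀ h h' i)).trans ?_)
    exact i.1.s_br _ _ _ _
  π_br c₁ c₀ h h' := val_ext fun i => by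
    refine (val_fpi _ i).trans (Eq.trans ?_ (val_one _ i).symm)
    refine (congrArg _ (val_fbr c₁ c₀ h h' i)).trans ((i.1.π_br _ _ _ _).trans ?_)
    exact congrArg _ (val_fpi c₁ i).symm
  br_self c h h' := val_ext fun i => by
    refine (val_fbr _ _ _ _ i).trans ((i.1.br_self _ _ _).trans ?_)
    exact (val_one (b := false) c i).symm

/-- The insertion of generators. -/
def unit : InftyGraph.Hom G (free n G).M.toInftyGraph where
  app g := mk (fun i => i.2.app g) ⟨.gen g, fun _ => rfl⟩
  map_s g := val_ext fun i => by
    refine (val_mk _ _ i).trans (Eq.trans ?_ (val_s _ i).symm)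
    rw [val_mk, i.2.map_s]
  map_t g := val_ext fun i => by
    refine (val_mk _ _ i).trans (Eq.trans ?_ (val_t _ i).symm)
    rw [val_mk, i.2.map_t]

variable {n G}

theorem val_unit {m : ℕ} (g : G.cell m) (i : Under n G) :
    val (b := false) ((unit n G).app g) i = i.2.app g := val_mk _ _ i

/-- Evaluation as a morphism of stretchings. -/
def desc (i : Under n G) : Stretching.Hom (free n G) i.1 where
  onM := valHom false i
  onC := valHom true i
  comm x := (val_fpi x i).symm
  map_br c₁ c₀ h h' := val_fbr c₁ c₀ h h' i

/-- The two components of a morphism from the free stretching. -/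
def comps {i : Under n G} (ψ : Stretching.Hom (free n G) i.1) :
    ∀ b, InftyNMagma.Hom (nmag n G b) (i.mag b)
  | false => ψ.onM
  | true => ψ.onC

theorem comps_eq {i : Under n G} (ψ : Stretching.Hom (free n G) i.1)
    (hψ : ∀ (m : ℕ) (g : G.cell m), ψ.onM.app ((unit n G).app g) = i.2.app g) :
    ∀ {b : Bool} {m : ℕ} (a : Term n G b m) (x : Cell n G b m), (∀ j, Ev j a (val x j)) →
      (comps ψ b).app x = val x i
  | _, _, .gen g, x, h => by
    obtain rfl : x = (unit n G).app g := val_ext fun j => (h j).trans (val_unit g j).symm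
    exact (hψ _ g).trans (val_unit g i).symm
  | b, _, .s a, x, h => by
    choose y hy e using h
    let y' : Cell n G b _ := mk y ⟨a, hy⟩
    obtain rfl : x = (graph n G b).s y' := val_ext fun j => by
      rw [val_s, e, val_mk]
    have ih := comps_eq ψ hψ a y' (fun j => by rw [val_mk]; exact hy j)
    rw [val_s, ← ih]
    exact (comps ψ b).map_s y'
  | b, _, .t a, x, h => by
    choose y hy e using h
    let y' : Cell n G b _ := mk y ⟨a, hy⟩
    obtain rfl : x = (graph n G b).t y' := val_ext fun j => by
      rw [val_t, e, val_mk]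
    have ih := comps_eq ψ hψ a y' (fun j => by rw [val_mk]; exact hy j)
    rw [val_t, ← ih]
    exact (comps ψ b).map_t y'
  | b, _, .one a, x, h => by
    choose y hy e using h
    let y' : Cell n G b _ := mk y ⟨a, hy⟩
    obtain rfl : x = (refl n G b).one y' := val_ext fun j => by
      rw [val_one, e, val_mk]
    have ih := comps_eq ψ hψ a y' (fun j => by rw [val_mk]; exact hy j)
    rw [val_one, ← ih]
    exact (comps ψ b).map_one y'
  | b, _, .comp hp a a', x, h => by
    choose y z hc hy hz e using h
    let y' : Cell n G b _ := mk y ⟨a, hy⟩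
    let z' : Cell n G b _ := mk z ⟨a', hz⟩
    have hc' : (graph n G b).Composable hp.le y' z' :=
      composable_iff.2 fun j => by rw [val_mk, val_mk]; exact hc j
    obtain rfl : x = fcomp n G hp y' z' hc' := val_ext fun j => by
      rw [val_comp, e]
      exact comp_congr _ hp (val_mk _ _ j).symm (val_mk _ _ j).symm _
    have ih := comps_eq ψ hψ a y' (fun j => by rw [val_mk]; exact hy j)
    have ih' := comps_eq ψ hψ a' z' (fun j => by rw [val_mk]; exact hz j)
    rw [val_comp]
    exact ((comps ψ b).map_comp hp y' z' hc').trans (comp_congr _ hp ih ih' _)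
  | b, _, .rev hn hp a, x, h => by
    choose y hy e using h
    let y' : Cell n G b _ := mk y ⟨a, hy⟩
    obtain rfl : x = frev n G hn hp y' := val_ext fun j => by
      rw [val_rev, e, val_mk]
    have ih := comps_eq ψ hψ a y' (fun j => by rw [val_mk]; exact hy j)
    rw [val_rev, ← ih]
    exact (comps ψ b).map_rev hn hp y'
  | _, _, .pi a, x, h => by
    choose y hy e using h
    let y' : Cell n G false _ := mk (b := false) y ⟨a, hy⟩
    have hy' : ∀ j, val y' j = y j := fun j => val_mk _ _ j
    obtain rfl : x = fpi y' := val_ext fun j => by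
      rw [val_fpi, e, hy']
    have ih := comps_eq ψ hψ a y' (fun j => by rw [hy']; exact hy j)
    rw [val_fpi, ← ih]
    exact (ψ.comm y').symm
  | _, _, .br a a', x, h => by
    choose y z hc hd hy hz e using h
    let y' : Cell n G false _ := mk (b := false) y ⟨a, hy⟩
    let z' : Cell n G false _ := mk (b := false) z ⟨a', hz⟩
    have hy' : ∀ j, val y' j = y j := fun j => val_mk _ _ j
    have hz' : ∀ j, val z' j = z j := fun j => val_mk _ _ j
    have br_congr : ∀ (j : Under n G) {m : ℕ} {c c' d d' : j.1.M.cell m} (hc : c = c')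
        (hd : d = d') (k : j.1.M.Parallel c d) (k' : j.1.π.app c = j.1.π.app d),
        j.1.br c d k k' = j.1.br c' d' (hc ▸ hd ▸ k) (hc ▸ hd ▸ k') := by
      intro j m c c' d d' hc hd k k'
      subst hc hd
      rfl
    have hc' : (graph n G false).Parallel y' z' := by
      rename_i m
      cases m with
      | zero => trivial
      | succ m =>
        refine ⟨val_ext fun j => ?_, val_ext fun j => ?_⟩
        · refine (val_t y' j).trans (Eq.trans ?_ (val_t z' j).symm)
          rw [hy', hz']
          exact (hc j).1
        · refine (val_s y' j).trans (Eq.trans ?_ (val_s z' j).symm)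
          rw [hy', hz']
          exact (hc j).2
    have hd' : fpi y' = fpi z' := val_ext fun j => by
      rw [val_fpi, val_fpi, hy', hz']
      exact hd j
    obtain rfl : x = fbr y' z' hc' hd' := val_ext fun j => by
      rw [val_fbr, e]
      exact br_congr j (hy' j).symm (hz' j).symm _ _
    have ih := comps_eq ψ hψ a y' (fun j => by rw [hy']; exact hy j)
    have ih' := comps_eq ψ hψ a' z' (fun j => by rw [hz']; exact hz j)
    rw [val_fbr]
    exact (ψ.map_br y' z' hc' hd').trans (br_congr i ih ih' _ _)

end FreeStretching

instance (n : ℕ) : (forgetStretching.{u} n).IsRightAdjoint := by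
  rw [isRightAdjoint_iff_hasInitial_structuredArrow]
  intro G
  let η : G ⟶ (forgetStretching n).obj (FreeStretching.free n G) := FreeStretching.unit n G
  have key : Limits.IsInitial (StructuredArrow.mk η) := by
    refine Limits.IsInitial.ofUniqueHom (fun X => ?_) (fun X ψ => ?_)
    · let i : FreeStretching.Under n G := ⟨X.right, X.hom⟩
      refine StructuredArrow.homMk (FreeStretching.desc i) ?_
      refine InftyGraph.Hom.ext ?_
      funext m g
      exact FreeStretching.val_mk _ _ i
    · let i : FreeStretching.Under n G := ⟨X.right, X.hom⟩
      refine StructuredArrow.ext _ _ ?_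
      have hψ : ∀ (m : ℕ) (g : G.cell m),
          (Stretching.Hom.onM ψ.right).app ((FreeStretching.unit n G).app g) = i.2.app g := by
        intro m g
        have := StructuredArrow.w ψ
        exact congrArg (fun k : InftyGraph.Hom G X.right.M.toInftyGraph => k.app g) this
      refine Stretching.Hom.ext' (fun m x => ?_) (fun m x => ?_)
      · obtain ⟨a, ha⟩ := FreeStretching.ex_val (b := false) x
        exact FreeStretching.comps_eq (i := i) ψ.right hψ a x ha
      · obtain ⟨a, ha⟩ := FreeStretching.ex_val (b := true) x
        exact FreeStretching.comps_eq (i := i) ψ.right hψ a x ha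
  exact key.hasInitial

/-! ## Weak `(∞, n)`-categories -/

/-- The free stretching functor, left adjoint to `forgetStretching n`. -/
def freeStretching (n : ℕ) : InftyGraph.{u} ⥤ Stretching.{u} n := (forgetStretching n).leftAdjoint

/-- The adjunction between the free stretching functor and the forgetful functor. -/
def stretchingAdjunction (n : ℕ) : freeStretching.{u} n ⊣ forgetStretching n :=
  Adjunction.ofIsRightAdjoint (forgetStretching n)

/-- The monad `𝕋^(∞, n)` on `∞`-graphs. -/
def weakMonad (n : ℕ) : Monad InftyGraph.{u} := (stretchingAdjunction n).toMonad

/-- Weak `(∞, n)`-categories: the algebras `(G, v)` of the monad `𝕋^(∞, n)`. -/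
abbrev WeakInftyNCat (n : ℕ) := (weakMonad.{u} n).Algebra

namespace WeakInftyNCat

variable {n : ℕ} (A : WeakInftyNCat.{u} n)

/-- The free stretching on the underlying `∞`-graph `G` of the algebra `(G, v)`. -/
def stretch : Stretching.{u} n := (freeStretching n).obj A.A

/-- The universal map `λ_G : G ⟶ M(G) = 𝕋(G)`, i.e. the unit of the adjunction. -/
def lam : InftyGraph.Hom A.A A.stretch.M.toInftyGraph := (stretchingAdjunction n).unit.app A.A

/-- The structure map `v : M(G) = 𝕋(G) ⟶ G` of the algebra. -/
def v : InftyGraph.Hom A.stretch.M.toInftyGraph A.A := A.a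

theorem v_lam {m : ℕ} (x : A.A.cell m) : A.v.app (A.lam.app x) = x :=
  congrArg (fun k : InftyGraph.Hom A.A A.A => k.app x) A.unit

/-- The canonical `(∞, n)`-magma structure on an algebra `(G, v)`: `ι a = v (1 (λ a))`,
`a ∘^m_p b = v (λ a ⋆^m_p λ b)` and `i^m_p a = v (j^m_p (λ a))`. -/
abbrev magma : InftyNMagma.{u} n where
  toInftyGraph := A.A
  one x := A.v.app (A.stretch.M.one (A.lam.app x))
  s_one x := by rw [← A.v.map_s, A.stretch.M.s_one, A.v_lam]
  t_one x := by rw [← A.v.map_t, A.stretch.M.t_one, A.v_lam]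
  comp hp y x h := A.v.app (A.stretch.M.comp hp (A.lam.app y) (A.lam.app x) (h.map A.lam))
  s_comp_top y x h := by
    rw [← A.v.map_s, A.stretch.M.s_comp_top, A.v.map_s, A.v_lam]
  t_comp_top y x h := by
    rw [← A.v.map_t, A.stretch.M.t_comp_top, A.v.map_t, A.v_lam]
  s_comp hp y x h h' := by
    rw [← A.v.map_s, A.stretch.M.s_comp hp _ _ _ ((h.map A.lam).s hp)]
    simp only [A.lam.map_s]
  t_comp hp y x h h' := by
    rw [← A.v.map_t, A.stretch.M.t_comp hp _ _ _ ((h.map A.lam).t hp)]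
    simp only [A.lam.map_t]
  rev hn hp x := A.v.app (A.stretch.M.rev hn hp (A.lam.app x))
  s_rev_top hn x := by
    rw [← A.v.map_s, A.stretch.M.s_rev_top, A.v.map_t, A.v_lam]
  t_rev_top hn x := by
    rw [← A.v.map_t, A.stretch.M.t_rev_top, A.v.map_s, A.v_lam]
  s_rev hn hp x := by
    rw [← A.v.map_s, A.stretch.M.s_rev hn hp, A.lam.map_s]
  t_rev hn hp x := by
    rw [← A.v.map_t, A.stretch.M.t_rev hn hp, A.lam.map_t]

/-- An algebra has dimension `d` if its canonical reflexive `∞`-graph has dimension `d`. -/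
def HasDimension (d : ℕ) : Prop := A.magma.toReflInftyGraph.HasDimension d

end WeakInftyNCat

end

/-! Two facts carry the proof.

The structure map is a morphism of magmas (`vHom`). The multiplication of the monad and the map 𝕋(v)
both come from morphisms of stretchings, so both preserve reflexors, compositions and reversors.
Comparing them through the algebra law v ∘ μ = v ∘ 𝕋(v) shows that v carries each operation of M(G)
to the corresponding operation of the canonical structure on G.

In dimension d, v identifies any two parallel d-cells of M(G) with the same image in the free strict
category (`HasDimension.v_eq_v`). The bracket of such a pair is a (d+1)-cell of M(G) joining them;
its image under v is an identity cell, whose source and target agree.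

Reversors are genuine inverses in the strict category C(G), so for each (m+1)-cell x of M(G) the
composite of x with its reverse and the identity on the target of x are parallel with the same image
under π; likewise on the other side. For m = 0 and x = λf, the brackets of these pairs are the cells
β and α of the statement, and `vHom` computes the sources of their images. For m = 1, x is λ of a
2-cell, and the second fact turns the pairs into equalities in G: every 2-cell has its reverse as an
inverse (`HasDimension.isInverse_rev`), in particular v(β) and v(α). The dimension enters only here;
the cells v(β) and v(α) exist in every algebra. -/

/-! ### Iterated operations of length one, and identity cells -/

theorem InftyGraph.src_one_step (X : InftyGraph.{u}) {m : ℕ} (h : m ≤ m + 1)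
    (x : X.cell (m + 1)) : X.src h x = X.s x := by
  rw [X.src_succ le_rfl, X.src_self]

theorem InftyGraph.tgt_one_step (X : InftyGraph.{u}) {m : ℕ} (h : m ≤ m + 1)
    (x : X.cell (m + 1)) : X.tgt h x = X.t x := by
  rw [X.tgt_succ le_rfl, X.tgt_self]

/-- Together with the two lemmas above, this translates `IsInverse`, phrased with `ones`, `tgt` and
`src`, into the one-step operations in which the axioms for reversors and brackets are stated. -/
theorem ReflInftyGraph.ones_one_step (X : ReflInftyGraph.{u}) {m : ℕ} (h : m ≤ m + 1)
    (x : X.cell m) : X.ones h x = X.one x := by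
  rw [X.ones_succ le_rfl, X.ones_self]

/-- The source and the target of an identity cell coincide. -/
theorem ReflInftyGraph.IsIdentity.s_eq_t {X : ReflInftyGraph.{u}} {m : ℕ} {x : X.cell (m + 1)}
    (hx : X.IsIdentity x) : X.s x = X.t x := by
  obtain ⟨p, h, y, rfl⟩ := hx
  -- The identity may start in any lower dimension `p`; since `p < m + 1`, its last reflexor can be
  -- split off, and that one alone determines the source and the target.
  rw [X.ones_succ (Nat.lt_succ_iff.1 h), X.s_one, X.t_one]

/-! ### Composites of a cell with its reverse -/

namespace InftyNMagma

variable {n : ℕ} (X : InftyNMagma.{u} n)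

theorem composable_rev {m : ℕ} (hn : n ≤ m) (x : X.cell (m + 1)) :
    X.Composable m.le_succ x (X.rev hn m.lt_succ_self x) :=
  X.composable_of_s_eq_t (X.t_rev_top hn x).symm

theorem rev_composable {m : ℕ} (hn : n ≤ m) (x : X.cell (m + 1)) :
    X.Composable m.le_succ (X.rev hn m.lt_succ_self x) x :=
  X.composable_of_s_eq_t (X.s_rev_top hn x)

/-- First of the two conditions for a bracket. It serves both for `m = 0`, where the bracket is a
coherence 2-cell of the statement, and for `m = 1`, where the bracket yields the invertibility of
2-cells. -/
theorem parallel_one_comp_rev {m : ℕ} (hn : n ≤ m) (x : X.cell (m + 1)) :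
    X.Parallel (X.one (X.t x))
      (X.comp m.lt_succ_self x (X.rev hn m.lt_succ_self x) (X.composable_rev hn x)) :=
  ⟨by rw [X.t_one, X.t_comp_top], by rw [X.s_one, X.s_comp_top, X.s_rev_top]⟩

theorem parallel_one_rev_comp {m : ℕ} (hn : n ≤ m) (x : X.cell (m + 1)) :
    X.Parallel (X.one (X.s x))
      (X.comp m.lt_succ_self (X.rev hn m.lt_succ_self x) x (X.rev_composable hn x)) :=
  ⟨by rw [X.t_one, X.t_comp_top, X.t_rev_top], by rw [X.s_one, X.s_comp_top]⟩

end InftyNMagma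

/-! ### Equality of the same composites after projection to the strict category -/

namespace Stretching

variable {n : ℕ} (E : Stretching.{u} n)

/-- Second condition for a bracket: π preserves all the operations, and in the strict category the
reverse of πx is its inverse. -/
theorem π_one_eq_π_comp_rev {m : ℕ} (hn : n ≤ m) (x : E.M.cell (m + 1)) :
    E.π.app (E.M.one (E.M.t x)) =
      E.π.app (E.M.comp m.lt_succ_self x (E.M.rev hn m.lt_succ_self x)
        (E.M.composable_rev hn x)) := by
  obtain ⟨h, e⟩ := (E.strict.isInverse_rev hn m.lt_succ_self (E.π.app x)).1
  rw [E.C.ones_one_step, E.C.tgt_one_step] at e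
  rw [E.π.map_one, E.π.map_t, E.π.map_comp, ← e]
  -- The composability proof inside `comp` depends on both factors, so the second factor is replaced
  -- by congruence and not by rewriting.
  exact FreeStretching.comp_congr _ _ rfl (E.π.map_rev hn _ x).symm _

theorem π_one_eq_π_rev_comp {m : ℕ} (hn : n ≤ m) (x : E.M.cell (m + 1)) :
    E.π.app (E.M.one (E.M.s x)) =
      E.π.app (E.M.comp m.lt_succ_self (E.M.rev hn m.lt_succ_self x) x
        (E.M.rev_composable hn x)) := by
  obtain ⟨h, e⟩ := (E.strict.isInverse_rev hn m.lt_succ_self (E.π.app x)).2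
  rw [E.C.ones_one_step, E.C.src_one_step] at e
  rw [E.π.map_one, E.π.map_s, E.π.map_comp, ← e]
  exact FreeStretching.comp_congr _ _ (E.π.map_rev hn _ x).symm rfl _

end Stretching

/-! ### The structure map as a morphism of magmas -/

namespace WeakInftyNCat

variable {n : ℕ} (A : WeakInftyNCat.{u} n)

/-- The multiplication `𝕋(M(G)) ⟶ M(G)`, as a morphism of `(∞, n)`-magmas. -/
noncomputable def mul : InftyNMagma.Hom ((freeStretching n).obj A.stretch.M.toInftyGraph).M A.stretch.M :=
  Stretching.Hom.onM ((stretchingAdjunction n).counit.app A.stretch)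

/-- The unit of the monad at `M(G)`. -/
noncomputable def lamFree : InftyGraph.Hom A.stretch.M.toInftyGraph
    ((freeStretching n).obj A.stretch.M.toInftyGraph).M.toInftyGraph :=
  (stretchingAdjunction n).unit.app A.stretch.M.toInftyGraph

/-- The image `𝕋(v)` of the structure map, as a morphism of `(∞, n)`-magmas. -/
noncomputable def mapV : InftyNMagma.Hom ((freeStretching n).obj A.stretch.M.toInftyGraph).M A.stretch.M :=
  Stretching.Hom.onM ((freeStretching n).map
    (show A.stretch.M.toInftyGraph ⟶ A.A from A.v))

/-- A triangle identity of the adjunction. -/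
theorem mul_lamFree {m : ℕ} (x : A.stretch.M.cell m) : A.mul.app (A.lamFree.app x) = x :=
  congrArg (fun k : InftyGraph.Hom A.stretch.M.toInftyGraph A.stretch.M.toInftyGraph => k.app x)
    ((stretchingAdjunction n).right_triangle_components A.stretch)

/-- Naturality of the unit, at the morphism v. -/
theorem mapV_lamFree {m : ℕ} (x : A.stretch.M.cell m) :
    A.mapV.app (A.lamFree.app x) = A.lam.app (A.v.app x) :=
  (congrArg (fun k : InftyGraph.Hom A.stretch.M.toInftyGraph A.stretch.M.toInftyGraph => k.app x)
    ((stretchingAdjunction n).unit.naturality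
      (show A.stretch.M.toInftyGraph ⟶ A.A from A.v))).symm

/-- The associativity law of the algebra, cell by cell. -/
theorem v_mul {m : ℕ} (x : ((freeStretching n).obj A.stretch.M.toInftyGraph).M.cell m) :
    A.v.app (A.mul.app x) = A.v.app (A.mapV.app x) :=
  congrArg (fun k : InftyGraph.Hom
    ((freeStretching n).obj A.stretch.M.toInftyGraph).M.toInftyGraph A.A => k.app x) A.assoc

/-- The structure map of an algebra is a morphism of `(∞, n)`-magmas. -/
noncomputable def vHom : InftyNMagma.Hom A.stretch.M A.magma where
  toHom := A.v
  map_one x := by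
    -- The algebra law is tested on the operation applied to generators of 𝕋(M(G)): μ sends it to
    -- the operation on `x`, and 𝕋(v) sends it to the operation on λ(v x). The image of the latter
    -- under v is the canonical operation on v x by definition. The other two fields follow the same
    -- pattern.
    have h := A.v_mul (ReflInftyGraph.one _ (A.lamFree.app x))
    rwa [A.mul.map_one, A.mapV.map_one, A.mul_lamFree, A.mapV_lamFree] at h
  map_comp hp y x hc := by
    have h := A.v_mul (InftyMagma.comp _ hp (A.lamFree.app y) (A.lamFree.app x)
      (hc.map A.lamFree))
    rw [A.mul.map_comp, A.mapV.map_comp] at h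
    simpa only [A.mul_lamFree, A.mapV_lamFree] using h
  map_rev hn hp x := by
    have h := A.v_mul (InftyNMagma.rev _ hn hp (A.lamFree.app x))
    rwa [A.mul.map_rev, A.mapV.map_rev, A.mul_lamFree, A.mapV_lamFree] at h

/-! ### Consequences of finite dimension -/

variable {A}

/-- In dimension `d`, the structure map identifies parallel `d`-cells that have equal images in
the free strict `(∞, n)`-category. -/
theorem HasDimension.v_eq_v {d : ℕ} (hA : A.HasDimension d) {c₁ c₀ : A.stretch.M.cell d}
    (h : A.stretch.M.Parallel c₁ c₀) (h' : A.stretch.π.app c₁ = A.stretch.π.app c₀) :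
    A.v.app c₁ = A.v.app c₀ := by
  -- The bracket lies one dimension above `d`, so its image under v is an identity cell.
  have e := (hA.1 (d + 1) d.lt_succ_self (A.v.app (A.stretch.br c₁ c₀ h h'))).s_eq_t
  change A.A.s _ = A.A.t _ at e
  rw [← A.v.map_s, ← A.v.map_t, A.stretch.s_br, A.stretch.t_br] at e
  exact e.symm

/-- In dimension `m + 1`, each `(m + 1)`-cell has its reverse as an inverse. -/
theorem HasDimension.isInverse_rev {m : ℕ} (hA : A.HasDimension (m + 1)) (hn : n ≤ m)
    (x : A.A.cell (m + 1)) :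
    A.magma.IsInverse m.lt_succ_self x (A.magma.rev hn m.lt_succ_self x) := by
  refine ⟨⟨A.magma.composable_rev hn x, ?_⟩, ⟨A.magma.rev_composable hn x, ?_⟩⟩
  · have h := hA.v_eq_v (A.stretch.M.parallel_one_comp_rev hn (A.lam.app x))
      (A.stretch.π_one_eq_π_comp_rev hn (A.lam.app x))
    rw [A.magma.ones_one_step, A.magma.tgt_one_step]
    -- The identity in `A.magma` is v applied to the reflexor of λ(t x), while `h` involves t(λ x).
    refine Eq.trans ?_ (h.symm.trans (by rw [← A.lam.map_t]))
    refine Eq.trans ?_ (A.vHom.map_comp _ _ _ _).symm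
    -- Only the first factor needs v(λ x) = x; the second is v(j(λ x)), the canonical reverse of `x`
    -- by definition.
    exact FreeStretching.comp_congr _ _ (A.v_lam x).symm rfl _
  · have h := hA.v_eq_v (A.stretch.M.parallel_one_rev_comp hn (A.lam.app x))
      (A.stretch.π_one_eq_π_rev_comp hn (A.lam.app x))
    rw [A.magma.ones_one_step, A.magma.src_one_step]
    refine Eq.trans ?_ (h.symm.trans (by rw [← A.lam.map_s]))
    refine Eq.trans ?_ (A.vHom.map_comp _ _ _ _).symm
    exact FreeStretching.comp_congr _ _ rfl (A.v_lam x).symm _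

end WeakInftyNCat

/-! ### The equivalence and its coherence cells -/

theorem mainTheorem2 (A : WeakInftyNCat.{u} 0) (hA : A.HasDimension 2)
    (a b : A.A.cell 0) (f : A.A.cell 1) (ha : A.A.s f = a) (hb : A.A.t f = b) :
    -- `f` is an equivalence
    A.magma.IsEquivalence f ∧
    -- the coherence cell `v(β) : f ∘ i(f) ⟹ ι(b)`, with `β = [1(λ b), λ f ⋆ j(λ f)]`
    (∃ (h : A.magma.Composable zero_le_one f (A.magma.rev le_rfl zero_lt_one f))
      (h' : A.stretch.M.Composable zero_le_one (A.lam.app f)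
        (A.stretch.M.rev le_rfl zero_lt_one (A.lam.app f)))
      (hpar : A.stretch.M.Parallel (A.stretch.M.one (A.lam.app b))
        (A.stretch.M.comp zero_lt_one (A.lam.app f)
          (A.stretch.M.rev le_rfl zero_lt_one (A.lam.app f)) h'))
      (hπ : A.stretch.π.app (A.stretch.M.one (A.lam.app b)) =
        A.stretch.π.app (A.stretch.M.comp zero_lt_one (A.lam.app f)
          (A.stretch.M.rev le_rfl zero_lt_one (A.lam.app f)) h'))
      (β : A.A.cell 2),
      β = A.v.app (A.stretch.br _ _ hpar hπ) ∧
      A.A.s β = A.magma.comp zero_lt_one f (A.magma.rev le_rfl zero_lt_one f) h ∧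
      A.A.t β = A.magma.one b ∧
      A.magma.IsInverse one_lt_two β (A.magma.rev zero_le_one one_lt_two β)) ∧
    -- the coherence cell `v(α) : i(f) ∘ f ⟹ ι(a)`, with `α = [1(λ a), j(λ f) ⋆ λ f]`
    (∃ (h : A.magma.Composable zero_le_one (A.magma.rev le_rfl zero_lt_one f) f)
      (h' : A.stretch.M.Composable zero_le_one
        (A.stretch.M.rev le_rfl zero_lt_one (A.lam.app f)) (A.lam.app f))
      (hpar : A.stretch.M.Parallel (A.stretch.M.one (A.lam.app a))
        (A.stretch.M.comp zero_lt_one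
          (A.stretch.M.rev le_rfl zero_lt_one (A.lam.app f)) (A.lam.app f) h'))
      (hπ : A.stretch.π.app (A.stretch.M.one (A.lam.app a)) =
        A.stretch.π.app (A.stretch.M.comp zero_lt_one
          (A.stretch.M.rev le_rfl zero_lt_one (A.lam.app f)) (A.lam.app f) h'))
      (α : A.A.cell 2),
      α = A.v.app (A.stretch.br _ _ hpar hπ) ∧
      A.A.s α = A.magma.comp zero_lt_one (A.magma.rev le_rfl zero_lt_one f) f h ∧
      A.A.t α = A.magma.one a ∧
      A.magma.IsInverse one_lt_two α (A.magma.rev zero_le_one one_lt_two α)) := by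
  subst ha hb
  -- The general lemmas concern the identity on t(λ f); the transports along `map_t` turn it into
  -- the identity on λ(t f), as in the statement. The cell α needs the same with sources.
  have hβ : A.A.s (A.v.app (A.stretch.br _ _
      (A.lam.map_t f ▸ A.stretch.M.parallel_one_comp_rev le_rfl (A.lam.app f))
      (A.lam.map_t f ▸ A.stretch.π_one_eq_π_comp_rev le_rfl (A.lam.app f)))) =
      A.magma.comp zero_lt_one f (A.magma.rev le_rfl zero_lt_one f)
        (A.magma.composable_rev le_rfl f) := by
    rw [← A.v.map_s, A.stretch.s_br]
    refine (A.vHom.map_comp _ _ _ _).trans ?_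
    exact FreeStretching.comp_congr _ _ (A.v_lam f) rfl _
  have hα : A.A.s (A.v.app (A.stretch.br _ _
      (A.lam.map_s f ▸ A.stretch.M.parallel_one_rev_comp le_rfl (A.lam.app f))
      (A.lam.map_s f ▸ A.stretch.π_one_eq_π_rev_comp le_rfl (A.lam.app f)))) =
      A.magma.comp zero_lt_one (A.magma.rev le_rfl zero_lt_one f) f
        (A.magma.rev_composable le_rfl f) := by
    rw [← A.v.map_s, A.stretch.s_br]
    refine (A.vHom.map_comp _ _ _ _).trans ?_
    exact FreeStretching.comp_congr _ _ rfl (A.v_lam f) _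
  have hβt : A.A.t (A.v.app (A.stretch.br _ _
      (A.lam.map_t f ▸ A.stretch.M.parallel_one_comp_rev le_rfl (A.lam.app f))
      (A.lam.map_t f ▸ A.stretch.π_one_eq_π_comp_rev le_rfl (A.lam.app f)))) =
      A.magma.one (A.A.t f) := by
    rw [← A.v.map_t, A.stretch.t_br]
  have hαt : A.A.t (A.v.app (A.stretch.br _ _
      (A.lam.map_s f ▸ A.stretch.M.parallel_one_rev_comp le_rfl (A.lam.app f))
      (A.lam.map_s f ▸ A.stretch.π_one_eq_π_rev_comp le_rfl (A.lam.app f)))) =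
      A.magma.one (A.A.s f) := by
    rw [← A.v.map_t, A.stretch.t_br]
  -- The types of `hβ` and `hα` determine the remaining witnesses: the quasi-inverse of `f` is its
  -- reverse, and the 2-cells are v(β) and v(α).
  exact ⟨⟨_, _, _, _, _, hβ, hβt, hα, hαt, ⟨_, hA.isInverse_rev zero_le_one _⟩,
      ⟨_, hA.isInverse_rev zero_le_one _⟩⟩,
    ⟨_, _, _, _, _, rfl, hβ, hβt, hA.isInverse_rev zero_le_one _⟩,
    ⟨_, _, _, _, _, rfl, hα, hαt, hA.isInverse_rev zero_le_one _⟩⟩
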